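/- Let $d$ be a natural number and let $\Omega\subset\mathbb{C}^d$ be an unbounded domain (non-empty, open, connected) that is Kobayashi hyperbolic, i.e. its Kobayashi pseudodistance $\mathsf{k}_\Omega$ is a distance; let $\kappa_\Omega$ be its Kobayashi–Royden metric. *End compactification.* Fix any exhaustion $(K_j)_{j}$ of $\overline\Omega$ by compact sets with $K_j\subset K_{j+1}^\circ$ (interior in $\overline\Omega$) and $\bigcup_j K_j=\overline\Omega$. An end of $\overline\Omega$ is a sequence $\mathfrak e=(F_j)_j$ where $F_j$ is a connected component of $\overline\Omega\setminus K_j$ and $F_{j+1}\subset F_j$. Let $\overline\Omega^{End}$ be the disjoint union of $\overline\Omega$ and the set of its ends; prescribe as basic neighbourhoods of $x\in\overline\Omega$ the neighbourhoods of $x$ in $\overline\Omega$, and of an end $\mathfrak e=(F_j)_j$ the sets $$\widehat F_j=F_j\cup\{\mathfrak f=(G_\nu)_\nu \text{ an end}: G_\nu=F_\nu \text{ for all } \nu\le j\}.$$ A subset of $\overline\Omega^{End}$ is open if it contains a basic neighbourhood of each of its points. *Visibility.* For $\kappa>0$, a $(1,\kappa)$-almost-geodesic is an absolutely continuous map $\sigma:[0,T]\to\Omega$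 such that $|s-t|-\kappa\le\mathsf{k}_\Omega(\sigma(s),\sigma(t))\le|s-t|+\kappa$ for all $s,t\in[0,T]$ and $\kappa_\Omega(\sigma(t);\sigma'(t))\le 1$ for almost every $t\in[0,T]$. The domain $\Omega$ has the visibility property with respect to $(1,\kappa)$-almost-geodesics if for every pair of distinct points $\zeta,\eta\in\overline\Omega^{End}\setminus\Omega$ there are neighbourhoods $V_\zeta$ of $\zeta$ and $V_\eta$ of $\eta$ in $\overline\Omega^{End}$ with disjoint closures, and a compact set $C\subset\Omega$, such that every $(1,\kappa)$-almost-geodesic $\sigma:[0,T]\to\Omega$ with $\sigma(0)\in V_\zeta$ and $\sigma(T)\in V_\eta$ satisfies $\sigma([0,T])\cap C\neq\emptyset$. **Theorem.** Suppose that, for some $\kappa>0$, $\Omega$ has the visibility property with respect to $(1,\kappa)$-almost-geodesics. Then, for every end $\mathfrak e=(F_j)_j$, the sets $\widehat F_j$ form a neighbourhood basis at $\mathfrak e$ in the topology of $\overline\Omega^{End}$, and the topological space $\overline\Omega^{End}$ is sequentially compact. -/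

import Mathlib

open Set Filter Topology MeasureTheory

noncomputable section

namespace Visibility

/-! ### Kobayashi distance and Kobayashi--Royden metric -/

/-- The Poincaré distance on the open unit disc of `ℂ`, normalised so that the infinitesimal
metric at the origin is the Euclidean one. -/
def poincareDist (a b : ℂ) : ℝ :=
  Real.artanh ‖(a - b) / (1 - (starRingEnd ℂ) b * a)‖

/-- `φ` is a holomorphic map from the open unit disc into `Ω`. -/
def IsAnalyticDisc {d : ℕ} (Ω : Set (EuclideanSpace ℂ (Fin d)))
    (φ : ℂ → EuclideanSpace ℂ (Fin d)) : Prop :=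
  DifferentiableOn ℂ φ (Metric.ball 0 1) ∧ MapsTo φ (Metric.ball 0 1) Ω

/-- `L` is the length of a finite chain of analytic discs in `Ω` joining `z` to `w`. -/
def IsChainLength {d : ℕ} (Ω : Set (EuclideanSpace ℂ (Fin d)))
    (z w : EuclideanSpace ℂ (Fin d)) (L : ℝ) : Prop :=
  ∃ (n : ℕ) (p : ℕ → EuclideanSpace ℂ (Fin d)) (φ : ℕ → ℂ → EuclideanSpace ℂ (Fin d))
    (a b : ℕ → ℂ),
    p 0 = z ∧ p n = w ∧
    (∀ i < n, IsAnalyticDisc Ω (φ i) ∧ a i ∈ Metric.ball 0 1 ∧ b i ∈ Metric.ball 0 1 ∧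
      φ i (a i) = p i ∧ φ i (b i) = p (i + 1)) ∧
    L = ∑ i ∈ Finset.range n, poincareDist (a i) (b i)

/-- The Kobayashi (pseudo)distance of `Ω`. On a domain any two points are joined by a chain of
analytic discs, so the infimum is over a nonempty set of nonnegative numbers. -/
def kobayashiDist {d : ℕ} (Ω : Set (EuclideanSpace ℂ (Fin d)))
    (z w : EuclideanSpace ℂ (Fin d)) : ℝ :=
  sInf {L : ℝ | IsChainLength Ω z w L}

/-- The Kobayashi--Royden (pseudo)metric of `Ω` at `z` in the direction `v`. -/
def kobayashiRoyden {d : ℕ} (Ω : Set (EuclideanSpace ℂ (Fin d)))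
    (z v : EuclideanSpace ℂ (Fin d)) : ℝ :=
  sInf {r : ℝ | ∃ (φ : ℂ → EuclideanSpace ℂ (Fin d)) (α : ℂ),
    IsAnalyticDisc Ω φ ∧ φ 0 = z ∧ α • deriv φ 0 = v ∧ r = ‖α‖}

/-- `Ω` is Kobayashi hyperbolic: its Kobayashi pseudodistance separates points. -/
def IsKobayashiHyperbolic {d : ℕ} (Ω : Set (EuclideanSpace ℂ (Fin d))) : Prop :=
  ∀ z ∈ Ω, ∀ w ∈ Ω, kobayashiDist Ω z w = 0 → z = w

/-- The restriction of `σ` to `[a, b]` is a `(lam, κ)`-almost-geodesic of `Ω`. Differentiability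
almost everywhere is automatic from absolute continuity; it is recorded so that `deriv σ t` is
visibly the derivative. -/
structure IsAlmostGeodesic {d : ℕ} (Ω : Set (EuclideanSpace ℂ (Fin d))) (lam κ : ℝ)
    (σ : ℝ → EuclideanSpace ℂ (Fin d)) (a b : ℝ) : Prop where
  mapsTo : MapsTo σ (Icc a b) Ω
  dist_lower : ∀ s ∈ Icc a b, ∀ t ∈ Icc a b,
    1 / lam * |s - t| - κ ≤ kobayashiDist Ω (σ s) (σ t)
  dist_upper : ∀ s ∈ Icc a b, ∀ t ∈ Icc a b,
    kobayashiDist Ω (σ s) (σ t) ≤ lam * |s - t| + κ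
  absolutelyContinuous : AbsolutelyContinuousOnInterval σ a b
  speed_le : ∀ᵐ t : ℝ, t ∈ Icc a b →
    DifferentiableAt ℝ σ t ∧ kobayashiRoyden Ω (σ t) (deriv σ t) ≤ lam

/-! ### The end compactification -/

/-- An end of `X` relative to the compact exhaustion `K`: a decreasing sequence `F j` of connected
components of the complements `X ∖ K j`. -/
@[ext]
structure SpaceEnd {X : Type*} [TopologicalSpace X] (K : CompactExhaustion X) where
  F : ℕ → Set X
  isComponent : ∀ j, ∃ x ∈ (K j)ᶜ, F j = connectedComponentIn (K j)ᶜ x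
  anti : ∀ j, F (j + 1) ⊆ F j

/-- The set underlying the end compactification: the points of `X` and the ends of `X`. -/
inductive EndCompactification {X : Type*} [TopologicalSpace X] (K : CompactExhaustion X) where
  | pt (x : X) : EndCompactification K
  | atEnd (e : SpaceEnd K) : EndCompactification K

namespace EndCompactification

/-- The `j`-th prescribed neighbourhood of the end `e`: the set `e.F j` together with all ends that
agree with `e` up to the index `j`. -/
def endNhd {X : Type*} [TopologicalSpace X] {K : CompactExhaustion X} (e : SpaceEnd K) (j : ℕ) :
    Set (EndCompactification K) :=
  pt '' e.F j ∪ atEnd '' {f : SpaceEnd K | ∀ i ≤ j, f.F i = e.F i}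

theorem endNhd_anti {X : Type*} [TopologicalSpace X] {K : CompactExhaustion X} (e : SpaceEnd K)
    {i j : ℕ} (h : i ≤ j) : endNhd e j ⊆ endNhd e i := by
  rintro p (⟨x, hx, rfl⟩ | ⟨f, hf, rfl⟩)
  · exact Or.inl ⟨x, antitone_nat_of_succ_le e.anti h hx, rfl⟩
  · exact Or.inr ⟨f, fun k hk => hf k (hk.trans h), rfl⟩

/-- The topology determined by the prescribed neighbourhoods: a set is open when it contains a
prescribed neighbourhood of each of its points, these being the neighbourhoods in `X` at a point
of `X` and the sets `endNhd e j` at an end `e`. -/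
instance {X : Type*} [TopologicalSpace X] (K : CompactExhaustion X) :
    TopologicalSpace (EndCompactification K) where
  IsOpen U := (∀ x : X, pt x ∈ U → pt ⁻¹' U ∈ 𝓝 x) ∧
    ∀ e : SpaceEnd K, atEnd e ∈ U → ∃ j, endNhd e j ⊆ U
  isOpen_univ := ⟨fun _ _ => univ_mem, fun _ _ => ⟨0, subset_univ _⟩⟩
  isOpen_inter := by
    rintro U V ⟨hU, hU'⟩ ⟨hV, hV'⟩
    refine ⟨fun x hx => inter_mem (hU x hx.1) (hV x hx.2), fun e he => ?_⟩
    obtain ⟨i, hi⟩ := hU' e he.1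
    obtain ⟨j, hj⟩ := hV' e he.2
    exact ⟨max i j, subset_inter ((endNhd_anti e (le_max_left i j)).trans hi)
      ((endNhd_anti e (le_max_right i j)).trans hj)⟩
  isOpen_sUnion := by
    intro S hS
    refine ⟨fun x hx => ?_, fun e he => ?_⟩
    · obtain ⟨U, hUS, hxU⟩ := hx
      exact mem_of_superset ((hS U hUS).1 x hxU) (fun y hy => ⟨U, hUS, hy⟩)
    · obtain ⟨U, hUS, heU⟩ := he
      obtain ⟨j, hj⟩ := (hS U hUS).2 e heU
      exact ⟨j, hj.trans (subset_sUnion_of_mem hUS)⟩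

/-- At a point of `X` the neighbourhoods are exactly the prescribed ones. -/
theorem isOpenEmbedding_pt {X : Type*} [TopologicalSpace X] (K : CompactExhaustion X) :
    IsOpenEmbedding (pt : X → EndCompactification K) := by
  refine IsOpenEmbedding.of_continuous_injective_isOpenMap ?_ ?_ ?_
  · exact continuous_def.2 fun U hU => isOpen_iff_mem_nhds.2 fun x hx => hU.1 x hx
  · intro x y h
    injection h
  · intro U hU
    refine ⟨?_, ?_⟩
    · rintro x ⟨y, hy, hxy⟩
      injection hxy with h
      subst h
      exact mem_of_superset (hU.mem_nhds hy) (fun z hz => ⟨z, hz, rfl⟩)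
    · rintro e ⟨y, -, hy⟩
      cases hy

end EndCompactification

/-! ### Visibility -/

/-- The points of a subset of the end compactification of the closure of `Ω` that lie in `ℂ^d`. -/
def finitePart {d : ℕ} {Ω : Set (EuclideanSpace ℂ (Fin d))}
    {K : CompactExhaustion (closure Ω)} (V : Set (EndCompactification K)) :
    Set (EuclideanSpace ℂ (Fin d)) :=
  {x | ∃ h : x ∈ closure Ω, EndCompactification.pt ⟨x, h⟩ ∈ V}

/-- The boundary of `Ω` in the end compactification of its closure: the complement of `Ω`. -/
def endBoundary {d : ℕ} (Ω : Set (EuclideanSpace ℂ (Fin d)))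
    (K : CompactExhaustion (closure Ω)) : Set (EndCompactification K) :=
  {p | ∀ x : closure Ω, p = EndCompactification.pt x → (x : EuclideanSpace ℂ (Fin d)) ∉ Ω}

/-- The pair `ζ, η` satisfies the visibility property with respect to
`(lam, κ)`-almost-geodesics. -/
def PairVisible {d : ℕ} (Ω : Set (EuclideanSpace ℂ (Fin d)))
    (K : CompactExhaustion (closure Ω)) (lam κ : ℝ) (ζ η : EndCompactification K) : Prop :=
  ∃ V ∈ 𝓝 ζ, ∃ W ∈ 𝓝 η, closure V ∩ closure W = ∅ ∧
    ∃ C : Set (EuclideanSpace ℂ (Fin d)), IsCompact C ∧ C ⊆ Ω ∧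
      ∀ (T : ℝ) (σ : ℝ → EuclideanSpace ℂ (Fin d)), 0 ≤ T →
        IsAlmostGeodesic Ω lam κ σ 0 T →
        σ 0 ∈ finitePart V → σ T ∈ finitePart W → (σ '' Icc 0 T ∩ C).Nonempty

/-- `Ω` satisfies the visibility property with respect to `(lam, κ)`-almost-geodesics. -/
def IsVisibilityDomain {d : ℕ} (Ω : Set (EuclideanSpace ℂ (Fin d)))
    (K : CompactExhaustion (closure Ω)) (lam κ : ℝ) : Prop :=
  ∀ ζ ∈ endBoundary Ω K, ∀ η ∈ endBoundary Ω K, ζ ≠ η → PairVisible Ω K lam κ ζ η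

end Visibility

end

noncomputable section

namespace Visibility

/-! The closure of `Ω` need not be locally connected at boundary points, so the components of the
complement of `K j` could be infinite in number and fail to be open. Visibility forbids this where
it matters: only finitely many of them reach outside `K (j + 2)`
(`IsVisibilityDomain.finite_components`).

Suppose infinitely many did so at points of `Ω`. An almost-geodesic from each of these points to a
fixed base point in another component must meet `K j`, so inside its own component it crosses from
the frontier of `K (j + 2)` to that of `K (j + 1)`. Along a subsequence the ends of the crossings
converge to distinct points. These lie in `∂Ω`, since near a point of `Ω` outside `K j` the
component is locally constant. By visibility the crossings meet a compact subset of `Ω`, and an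
accumulation point there contradicts the same local constancy. Density of `Ω` in its closure extends
the count to all points.

Finiteness gives both conclusions. Components are relatively closed, so a point outside `K (j + 2)`
is interior to its component (`component_mem_nhds`), which makes the prescribed sets neighbourhoods
of ends. A sequence leaving every `K j` is sorted by pigeonhole into nested components, which form
an end to which a subsequence converges.

The almost-geodesics are built by hand from nearly optimal chains of discs
(`exists_isAlmostGeodesic`), without comparing the Kobayashi distance with the integrated metric. -/

/-! ### The Möbius automorphisms of the unit disc -/

/-- The automorphism of the unit disc that sends `0` to `c`. -/
def mobius (c z : ℂ) : ℂ := (z + c) / (1 + (starRingEnd ℂ) c * z)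

theorem one_add_conj_mul_ne_zero {c z : ℂ} (hc : ‖c‖ < 1) (hz : ‖z‖ < 1) :
    1 + (starRingEnd ℂ) c * z ≠ 0 := by
  intro h
  have h1 : (starRingEnd ℂ) c * z = -1 := by linear_combination h
  have h2 : ‖c‖ * ‖z‖ = 1 := by simpa using congrArg norm h1
  nlinarith [norm_nonneg c, norm_nonneg z]

/-- Rests on |1 + c̄z|² − |z + c|² = (1 − |c|²)(1 − |z|²). -/
theorem norm_mobius_lt_one {c z : ℂ} (hc : ‖c‖ < 1) (hz : ‖z‖ < 1) : ‖mobius c z‖ < 1 := by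
  have hne := one_add_conj_mul_ne_zero hc hz
  rw [mobius, norm_div, div_lt_one (norm_pos_iff.2 hne)]
  refine lt_of_pow_lt_pow_left₀ 2 (norm_nonneg _) ?_
  have hc2 : ‖c‖ ^ 2 < 1 := by nlinarith [norm_nonneg c]
  have hz2 : ‖z‖ ^ 2 < 1 := by nlinarith [norm_nonneg z]
  rw [← Complex.normSq_eq_norm_sq] at *
  rw [← Complex.normSq_eq_norm_sq] at *
  simp only [Complex.normSq_apply, Complex.add_re, Complex.add_im, Complex.mul_re, Complex.mul_im,
    Complex.conj_re, Complex.conj_im, Complex.one_re, Complex.one_im] at *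
  nlinarith [mul_pos (sub_pos.2 hc2) (sub_pos.2 hz2)]

theorem mobius_neg_right_inv {c z : ℂ} (hc : ‖c‖ < 1) (hz : ‖z‖ < 1) :
    mobius c (mobius (-c) z) = z := by
  have h1 := one_add_conj_mul_ne_zero (c := -c) (by simpa using hc) hz
  have h2 : mobius (-c) z * (1 + (starRingEnd ℂ) (-c) * z) = z + -c := div_mul_cancel₀ _ h1
  rw [map_neg] at h2
  rw [mobius, div_eq_iff (one_add_conj_mul_ne_zero hc (norm_mobius_lt_one (by simpa using hc) hz))]
  linear_combination h2

theorem differentiableOn_mobius {c : ℂ} (hc : ‖c‖ < 1) :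
    DifferentiableOn ℂ (mobius c) (Metric.ball 0 1) := by
  unfold mobius
  refine DifferentiableOn.div (by fun_prop) (by fun_prop) fun z hz => ?_
  exact one_add_conj_mul_ne_zero hc (by simpa using hz)

theorem hasDerivAt_mobius_zero (c : ℂ) :
    HasDerivAt (mobius c) (1 - (starRingEnd ℂ) c * c) 0 := by
  unfold mobius
  have h1 : HasDerivAt (fun z : ℂ => z + c) 1 0 := (hasDerivAt_id 0).add_const c
  have h2 : HasDerivAt (fun z : ℂ => 1 + (starRingEnd ℂ) c * z) ((starRingEnd ℂ) c) 0 := by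
    simpa using ((hasDerivAt_id (0 : ℂ)).const_mul ((starRingEnd ℂ) c)).const_add 1
  have h := h1.fun_div h2 (by simp)
  simpa [mul_comm] using h

/-! ### The Poincaré distance -/

theorem poincareDist_comm (a b : ℂ) : poincareDist a b = poincareDist b a := by
  unfold poincareDist
  rw [norm_div, norm_div, norm_sub_rev]
  congr 2
  rw [← Complex.norm_conj]
  simp [mul_comm]

theorem poincareDist_eq_artanh_norm_mobius (a b : ℂ) :
    poincareDist a b = Real.artanh ‖mobius (-a) b‖ := by
  rw [poincareDist_comm]
  simp [poincareDist, mobius, sub_eq_add_neg]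

theorem poincareDist_nonneg {a b : ℂ} (ha : ‖a‖ < 1) (hb : ‖b‖ < 1) : 0 ≤ poincareDist a b := by
  rw [poincareDist_eq_artanh_norm_mobius]
  have h := norm_mobius_lt_one (c := -a) (by simpa using ha) hb
  rw [← Real.artanh_zero, Real.artanh_le_artanh_iff (by norm_num)
    ⟨by linarith [norm_nonneg (mobius (-a) b)], h⟩]
  exact norm_nonneg _

theorem tanh_sub_eq (s t : ℝ) :
    Real.tanh (s - t) = (Real.tanh s - Real.tanh t) / (1 - Real.tanh t * Real.tanh s) := by
  have hs := (Real.cosh_pos s).ne'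
  have ht := (Real.cosh_pos t).ne'
  have hst := (Real.cosh_pos (s - t)).ne'
  rw [Real.cosh_sub] at hst
  rw [Real.tanh_eq_sinh_div_cosh, Real.tanh_eq_sinh_div_cosh, Real.tanh_eq_sinh_div_cosh,
    Real.sinh_sub, Real.cosh_sub]
  have h1 : 1 - Real.sinh t / Real.cosh t * (Real.sinh s / Real.cosh s) =
    (Real.cosh s * Real.cosh t - Real.sinh s * Real.sinh t) / (Real.cosh s * Real.cosh t) := by
    field_simp
  rw [h1]
  field_simp

/-- Unit-speed parametrisation of the real diameter: time elapsed along `φ (tanh t)` is chain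
length. -/
theorem poincareDist_tanh (s t : ℝ) :
    poincareDist (Real.tanh s : ℂ) (Real.tanh t : ℂ) = |s - t| := by
  have h : (((Real.tanh s : ℂ) - Real.tanh t) /
      (1 - (starRingEnd ℂ) (Real.tanh t : ℂ) * Real.tanh s)) = ((Real.tanh (s - t) : ℝ) : ℂ) := by
    rw [tanh_sub_eq, Complex.conj_ofReal]
    push_cast
    rfl
  rw [poincareDist, h, Complex.norm_real, Real.norm_eq_abs]
  rcases le_total 0 (s - t) with hst | hst
  · have h0 : 0 ≤ Real.tanh (s - t) := by
      rw [Real.tanh_eq_sinh_div_cosh]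
      exact div_nonneg (Real.sinh_nonneg_iff.2 hst) (Real.cosh_pos _).le
    rw [abs_of_nonneg h0, Real.artanh_tanh, abs_of_nonneg hst]
  · have h0 : Real.tanh (s - t) ≤ 0 := by
      rw [Real.tanh_eq_sinh_div_cosh]
      exact div_nonpos_of_nonpos_of_nonneg (Real.sinh_nonpos_iff.2 hst) (Real.cosh_pos _).le
    rw [abs_of_nonpos h0, ← Real.tanh_neg, Real.artanh_tanh, abs_of_nonpos hst]

theorem hasDerivAt_tanh (t : ℝ) : HasDerivAt Real.tanh (1 - Real.tanh t * Real.tanh t) t := by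
  have hc := (Real.cosh_pos t).ne'
  have h := (Real.hasDerivAt_sinh t).div (Real.hasDerivAt_cosh t) hc
  have he : Real.tanh = Real.sinh / Real.cosh := by
    ext x
    simp [Real.tanh_eq_sinh_div_cosh]
  rw [← he] at h
  refine h.congr_deriv ?_
  rw [Real.tanh_eq_sinh_div_cosh]
  field_simp

theorem contDiff_tanh : ContDiff ℝ 1 Real.tanh := by
  have he : Real.tanh = fun x => Real.sinh x / Real.cosh x := by
    ext x
    simp [Real.tanh_eq_sinh_div_cosh]
  rw [he]
  exact Real.contDiff_sinh.div Real.contDiff_cosh fun x => (Real.cosh_pos x).ne'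

/-! ### Chains of analytic discs -/

variable {d : ℕ} {Ω : Set (EuclideanSpace ℂ (Fin d))}

theorem IsAnalyticDisc.comp {φ : ℂ → EuclideanSpace ℂ (Fin d)} (hφ : IsAnalyticDisc Ω φ)
    {g : ℂ → ℂ} (hg : DifferentiableOn ℂ g (Metric.ball 0 1))
    (hmaps : MapsTo g (Metric.ball 0 1) (Metric.ball 0 1)) : IsAnalyticDisc Ω (φ ∘ g) :=
  ⟨hφ.1.comp hg hmaps, hφ.2.comp hmaps⟩

theorem mapsTo_mobius {c : ℂ} (hc : ‖c‖ < 1) :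
    MapsTo (mobius c) (Metric.ball 0 1) (Metric.ball 0 1) := fun z hz => by
  simpa using norm_mobius_lt_one hc (by simpa using hz)

theorem IsChainLength.nonneg {z w : EuclideanSpace ℂ (Fin d)} {L : ℝ}
    (h : IsChainLength Ω z w L) : 0 ≤ L := by
  obtain ⟨n, p, φ, a, b, -, -, h, rfl⟩ := h
  refine Finset.sum_nonneg fun i hi => ?_
  obtain ⟨-, ha, hb, -⟩ := h i (Finset.mem_range.1 hi)
  exact poincareDist_nonneg (by simpa using ha) (by simpa using hb)

theorem IsChainLength.refl (z : EuclideanSpace ℂ (Fin d)) : IsChainLength Ω z z 0 :=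
  ⟨0, fun _ => z, fun _ _ => 0, fun _ => 0, fun _ => 0, rfl, rfl, by simp, by simp⟩

theorem IsAnalyticDisc.isChainLength {φ : ℂ → EuclideanSpace ℂ (Fin d)} (hφ : IsAnalyticDisc Ω φ)
    {a b : ℂ} (ha : a ∈ Metric.ball (0 : ℂ) 1) (hb : b ∈ Metric.ball (0 : ℂ) 1) :
    IsChainLength Ω (φ a) (φ b) (poincareDist a b) :=
  ⟨1, fun i => if i = 0 then φ a else φ b, fun _ => φ, fun _ => a, fun _ => b, by simp, by simp,
    fun i hi => by
      obtain rfl : i = 0 := by omega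
      simp [hφ, -Metric.mem_ball, ha, hb], by simp⟩

theorem IsChainLength.trans {z w u : EuclideanSpace ℂ (Fin d)} {L M : ℝ}
    (h₁ : IsChainLength Ω z w L) (h₂ : IsChainLength Ω w u M) : IsChainLength Ω z u (L + M) := by
  obtain ⟨n, p, φ, a, b, hp0, hpn, h, rfl⟩ := h₁
  obtain ⟨m, q, ψ, a', b', hq0, hqm, h', rfl⟩ := h₂
  refine ⟨n + m, fun i => if i < n then p i else q (i - n),
    fun i => if i < n then φ i else ψ (i - n), fun i => if i < n then a i else a' (i - n),
    fun i => if i < n then b i else b' (i - n), ?_, ?_, ?_, ?_⟩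
  · rcases Nat.eq_zero_or_pos n with rfl | hn
    · simp [hq0, ← hpn, hp0]
    · simp [hn, hp0]
  · simp [hqm]
  · intro i hi
    by_cases hin : i < n
    · obtain ⟨h1, h2, h3, h4, h5⟩ := h i hin
      refine ⟨by simpa [hin] using h1, by simpa [hin] using h2, by simpa [hin] using h3,
        by simpa [hin] using h4, ?_⟩
      by_cases hin' : i + 1 < n
      · simpa [hin, hin'] using h5
      · obtain rfl : n = i + 1 := by omega
        simp [h5, hpn, hq0]
    · obtain ⟨h1, h2, h3, h4, h5⟩ := h' (i - n) (by omega)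
      have e : i + 1 - n = i - n + 1 := by omega
      have hin' : ¬ i + 1 < n := by omega
      refine ⟨by simpa [hin] using h1, by simpa [hin] using h2, by simpa [hin] using h3,
        by simpa [hin] using h4, by simpa [hin, hin', e] using h5⟩
  · rw [Finset.sum_range_add]
    congr 1
    · exact Finset.sum_congr rfl fun i hi => by simp [Finset.mem_range.1 hi]
    · simp

theorem IsChainLength.symm {z w : EuclideanSpace ℂ (Fin d)} {L : ℝ}
    (h : IsChainLength Ω z w L) : IsChainLength Ω w z L := by
  obtain ⟨n, p, φ, a, b, rfl, rfl, h, rfl⟩ := h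
  induction n with
  | zero => exact .refl _
  | succ n ih =>
    obtain ⟨hφ, ha, hb, h0, h1⟩ := h n n.lt_succ_self
    have h2 := hφ.isChainLength hb ha
    rw [h0, h1, poincareDist_comm] at h2
    rw [Finset.sum_range_succ, add_comm (Finset.sum _ _)]
    exact h2.trans (ih fun i hi => h i (by omega))

/-- Being joined by a chain is symmetric, transitive and true locally, so connectedness makes it
global. Without a chain the infimum would be the junk value `0`, approximated by no chain. -/
theorem exists_isChainLength (hopen : IsOpen Ω) (hconn : IsPreconnected Ω)
    {z w : EuclideanSpace ℂ (Fin d)} (hz : z ∈ Ω) (hw : w ∈ Ω) : ∃ L, IsChainLength Ω z w L := by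
  refine hconn.induction₂ (fun z w => ∃ L, IsChainLength Ω z w L) (fun x hx => ?_)
    (fun x y u _ _ _ ⟨L, hL⟩ ⟨M, hM⟩ => ⟨L + M, hL.trans hM⟩)
    (fun x y _ _ ⟨L, hL⟩ => ⟨L, hL.symm⟩) hz hw
  obtain ⟨r, hr, hball⟩ := Metric.isOpen_iff.1 hopen x hx
  filter_upwards [mem_nhdsWithin_of_mem_nhds (Metric.ball_mem_nhds x (half_pos hr))] with y hy
  -- The affine disc with `x` at `0` and `y` at `1/2`; its radius `2‖y - x‖` is below `r`.
  have hφ : IsAnalyticDisc Ω (fun ζ : ℂ => x + ζ • ((2 : ℂ) • (y - x))) := by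
    refine ⟨by fun_prop, fun ζ hζ => hball ?_⟩
    rw [mem_ball_iff_norm] at hy ⊢
    rw [mem_ball_zero_iff] at hζ
    simp only [add_sub_cancel_left, norm_smul, Complex.norm_ofNat]
    nlinarith [norm_nonneg (y - x), norm_nonneg ζ]
  have h := hφ.isChainLength (a := 0) (b := 2⁻¹) (by simp) (by simp; norm_num)
  exact ⟨_, by simpa [smul_smul] using h⟩

theorem kobayashiDist_le {z w : EuclideanSpace ℂ (Fin d)} {L : ℝ} (h : IsChainLength Ω z w L) :
    kobayashiDist Ω z w ≤ L :=
  csInf_le ⟨0, fun _ h => h.nonneg⟩ h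

theorem kobayashiDist_comm (z w : EuclideanSpace ℂ (Fin d)) :
    kobayashiDist Ω z w = kobayashiDist Ω w z := by
  unfold kobayashiDist
  congr 1
  ext L
  exact ⟨IsChainLength.symm, IsChainLength.symm⟩

theorem exists_isChainLength_lt {z w : EuclideanSpace ℂ (Fin d)}
    (h : ∃ L, IsChainLength Ω z w L) {ε : ℝ} (hε : 0 < ε) :
    ∃ L, IsChainLength Ω z w L ∧ L < kobayashiDist Ω z w + ε := by
  obtain ⟨L, hL, hlt⟩ := exists_lt_of_csInf_lt (s := {L | IsChainLength Ω z w L}) h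
    (lt_add_of_pos_right (kobayashiDist Ω z w) hε)
  exact ⟨L, hL, hlt⟩

theorem kobayashiRoyden_le_one_of_deriv {φ : ℂ → EuclideanSpace ℂ (Fin d)}
    (hφ : IsAnalyticDisc Ω φ) : kobayashiRoyden Ω (φ 0) (deriv φ 0) ≤ 1 :=
  csInf_le ⟨0, by rintro r ⟨-, α, -, -, -, rfl⟩; exact norm_nonneg α⟩
    ⟨φ, 1, hφ, rfl, one_smul _ _, by simp⟩

/-! ### Curves traced by chains of discs -/

/-- `σ` is Lipschitz on `[0, T]`, has Kobayashi--Royden speed at most one, and any two of its points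
are joined by a chain of discs no longer than the parameter interval between them. -/
structure IsChainCurve (Ω : Set (EuclideanSpace ℂ (Fin d))) (σ : ℝ → EuclideanSpace ℂ (Fin d))
    (T : ℝ) : Prop where
  mapsTo : MapsTo σ (Icc 0 T) Ω
  chain : ∀ s ∈ Icc 0 T, ∀ t ∈ Icc 0 T, s ≤ t → IsChainLength Ω (σ s) (σ t) (t - s)
  lipschitz : ∃ C, LipschitzOnWith C σ (Icc 0 T)
  speed_le : ∀ᵐ t : ℝ, t ∈ Icc 0 T →
    DifferentiableAt ℝ σ t ∧ kobayashiRoyden Ω (σ t) (deriv σ t) ≤ 1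

theorem tanh_ofReal_mem_ball (t : ℝ) : (Real.tanh t : ℂ) ∈ Metric.ball (0 : ℂ) 1 := by
  rw [mem_ball_zero_iff, Complex.norm_real]
  exact Real.abs_tanh_lt_one t

theorem IsAnalyticDisc.hasDerivAt_comp_tanh {φ : ℂ → EuclideanSpace ℂ (Fin d)}
    (hφ : IsAnalyticDisc Ω φ) (t : ℝ) :
    HasDerivAt (fun t : ℝ => φ (Real.tanh t))
      ((1 - (Real.tanh t : ℂ) * Real.tanh t) • deriv φ (Real.tanh t)) t := by
  have h1 : HasDerivAt φ (deriv φ (Real.tanh t)) ((Real.tanh t : ℝ) : ℂ) :=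
    (hφ.1.differentiableAt (Metric.isOpen_ball.mem_nhds (tanh_ofReal_mem_ball t))).hasDerivAt
  have h2 : HasDerivAt (fun t : ℝ => ((Real.tanh t : ℝ) : ℂ))
      ((1 - Real.tanh t * Real.tanh t : ℝ) : ℂ) t := (hasDerivAt_tanh t).ofReal_comp
  have h := HasDerivAt.scomp t h1 h2
  rwa [Complex.ofReal_sub, Complex.ofReal_mul, Complex.ofReal_one] at h

/-- Recentre the disc by the automorphism taking `0` to `tanh t`. Its derivative at `0` is `1 -
tanh² t`, also the speed of `tanh`, so the velocity of the curve is the derivative at `0` of the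
recentred disc. -/
theorem IsAnalyticDisc.kobayashiRoyden_comp_tanh_le {φ : ℂ → EuclideanSpace ℂ (Fin d)}
    (hφ : IsAnalyticDisc Ω φ) (t : ℝ) :
    kobayashiRoyden Ω (φ (Real.tanh t)) (deriv (fun t : ℝ => φ (Real.tanh t)) t) ≤ 1 := by
  have hc : ‖(Real.tanh t : ℂ)‖ < 1 := by simpa using tanh_ofReal_mem_ball t
  have h := kobayashiRoyden_le_one_of_deriv
    (hφ.comp (differentiableOn_mobius hc) (mapsTo_mobius hc))
  have h0 : mobius (Real.tanh t : ℂ) 0 = (Real.tanh t : ℂ) := by simp [mobius]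
  have h1 : HasDerivAt φ (deriv φ (Real.tanh t)) (mobius (Real.tanh t : ℂ) 0) := by
    rw [h0]
    exact (hφ.1.differentiableAt
      (Metric.isOpen_ball.mem_nhds (tanh_ofReal_mem_ball t))).hasDerivAt
  have h2 := (HasDerivAt.scomp 0 h1 (hasDerivAt_mobius_zero (Real.tanh t : ℂ))).deriv
  rw [h2, Function.comp_apply, h0, Complex.conj_ofReal] at h
  rwa [(hφ.hasDerivAt_comp_tanh t).deriv]

theorem IsAnalyticDisc.isChainCurve {φ : ℂ → EuclideanSpace ℂ (Fin d)}
    (hφ : IsAnalyticDisc Ω φ) (T : ℝ) : IsChainCurve Ω (fun t => φ (Real.tanh t)) T where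
  mapsTo t _ := hφ.2 (tanh_ofReal_mem_ball t)
  chain s _ t _ hst := by
    have h := hφ.isChainLength (tanh_ofReal_mem_ball s) (tanh_ofReal_mem_ball t)
    rwa [poincareDist_tanh, abs_sub_comm, abs_of_nonneg (sub_nonneg.2 hst)] at h
  lipschitz := by
    have h1 : ContDiffOn ℝ 1 φ (Metric.ball 0 1) :=
      (hφ.1.contDiffOn (n := 1) Metric.isOpen_ball).restrict_scalars ℝ
    have h2 : ContDiff ℝ 1 (fun t : ℝ => ((Real.tanh t : ℝ) : ℂ)) :=
      Complex.ofRealCLM.contDiff.comp contDiff_tanh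
    have h3 : ContDiffOn ℝ 1 (fun t : ℝ => φ (Real.tanh t)) (Icc 0 T) :=
      h1.comp h2.contDiffOn fun t _ => tanh_ofReal_mem_ball t
    exact h3.exists_lipschitzOnWith (by decide) (convex_Icc _ _) isCompact_Icc
  speed_le := ae_of_all _ fun t _ =>
    ⟨(hφ.hasDerivAt_comp_tanh t).differentiableAt, hφ.kobayashiRoyden_comp_tanh_le t⟩

/-- An automorphism and a rotation by `u` move `a` to `0` and `b` to the nonnegative real `‖m‖`,
which is `tanh` of the Poincaré distance; the curve then follows the real diameter. -/
theorem IsAnalyticDisc.exists_isChainCurve {φ : ℂ → EuclideanSpace ℂ (Fin d)}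
    (hφ : IsAnalyticDisc Ω φ) {a b : ℂ} (ha : a ∈ Metric.ball (0 : ℂ) 1)
    (hb : b ∈ Metric.ball (0 : ℂ) 1) :
    ∃ σ, IsChainCurve Ω σ (poincareDist a b) ∧ σ 0 = φ a ∧ σ (poincareDist a b) = φ b := by
  rw [mem_ball_zero_iff] at ha hb
  set m := mobius (-a) b with hm
  have hm1 : ‖m‖ < 1 := norm_mobius_lt_one (by simpa using ha) hb
  obtain ⟨u, hu, hum⟩ : ∃ u : ℂ, ‖u‖ = 1 ∧ u * ‖m‖ = m := by
    by_cases h0 : m = 0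
    · exact ⟨1, by simp, by simp [h0]⟩
    · refine ⟨m / ‖m‖, by simp [h0], ?_⟩
      rw [div_mul_cancel₀]
      simpa using h0
  have hψ : IsAnalyticDisc Ω ((φ ∘ mobius a) ∘ fun z => u * z) := by
    refine (hφ.comp (differentiableOn_mobius ha) (mapsTo_mobius ha)).comp (by fun_prop) ?_
    intro z hz
    simpa [hu] using hz
  refine ⟨_, hψ.isChainCurve _, by simp [mobius], ?_⟩
  rw [poincareDist_eq_artanh_norm_mobius, ← hm,
    Real.tanh_artanh ⟨by linarith [norm_nonneg m], hm1⟩]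
  simp only [Function.comp_apply]
  rw [hum, hm, mobius_neg_right_inv ha hb]

theorem IsChainCurve.const {z : EuclideanSpace ℂ (Fin d)} (hz : z ∈ Ω) :
    IsChainCurve Ω (fun _ => z) 0 where
  mapsTo _ _ := hz
  chain s hs t ht _ := by
    obtain rfl : s = 0 := by simpa using hs
    obtain rfl : t = 0 := by simpa using ht
    simpa using IsChainLength.refl z
  lipschitz := ⟨0, (LipschitzWith.const z).lipschitzOnWith⟩
  speed_le := by
    filter_upwards [compl_mem_ae_iff.2 (measure_singleton (0 : ℝ))] with t ht ht'
    exact absurd (by simpa using ht') ht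

theorem IsChainCurve.trans {σ τ : ℝ → EuclideanSpace ℂ (Fin d)} {S T : ℝ} (hS : 0 ≤ S)
    (hT : 0 ≤ T) (hσ : IsChainCurve Ω σ S) (hτ : IsChainCurve Ω τ T) (hστ : σ S = τ 0) :
    IsChainCurve Ω (fun t => if t ≤ S then σ t else τ (t - S)) (S + T) where
  mapsTo t ht := by
    by_cases h : t ≤ S
    · simpa [h] using hσ.mapsTo ⟨ht.1, h⟩
    · simpa [h] using hτ.mapsTo (x := t - S) ⟨by linarith, by linarith [ht.2]⟩
  chain s hs t ht hst := by
    by_cases h : t ≤ S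
    · simpa [h, hst.trans h] using hσ.chain s ⟨hs.1, hst.trans h⟩ t ⟨ht.1, h⟩ hst
    · have ht' : t - S ∈ Icc 0 T := ⟨by linarith, by linarith [ht.2]⟩
      by_cases h' : s ≤ S
      · have h1 := hσ.chain s ⟨hs.1, h'⟩ S ⟨hS, le_rfl⟩ h'
        have h2 := hτ.chain 0 ⟨le_rfl, hT⟩ (t - S) ht' ht'.1
        rw [hστ] at h1
        simpa [h, h'] using h1.trans h2
      · have h2 := hτ.chain (s - S) ⟨by linarith, by linarith [hs.2]⟩ (t - S) ht' (by linarith)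
        simpa [h, h'] using h2
  lipschitz := by
    obtain ⟨A, hA⟩ := hσ.lipschitz
    obtain ⟨B, hB⟩ := hτ.lipschitz
    refine ⟨max A B, LipschitzOnWith.of_dist_le_mul ?_⟩
    have key : ∀ s ∈ Icc 0 (S + T), ∀ t ∈ Icc 0 (S + T), s ≤ t →
        dist (if s ≤ S then σ s else τ (s - S)) (if t ≤ S then σ t else τ (t - S)) ≤
          (max A B : NNReal) * (t - s) := by
      intro s hs t ht hst
      have hA' : ((A : NNReal) : ℝ) ≤ (max A B : NNReal) := by exact_mod_cast le_max_left A B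
      have hB' : ((B : NNReal) : ℝ) ≤ (max A B : NNReal) := by exact_mod_cast le_max_right A B
      by_cases h : t ≤ S
      · have h1 := hA.dist_le_mul s ⟨hs.1, hst.trans h⟩ t ⟨ht.1, h⟩
        rw [dist_comm s t, Real.dist_eq, abs_of_nonneg (sub_nonneg.2 hst)] at h1
        simp only [h, hst.trans h, if_true]
        exact h1.trans (mul_le_mul_of_nonneg_right hA' (by linarith))
      · have ht' : t - S ∈ Icc 0 T := ⟨by linarith, by linarith [ht.2]⟩
        by_cases h' : s ≤ S
        · have h1 := hA.dist_le_mul s ⟨hs.1, h'⟩ S ⟨hS, le_rfl⟩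
          have h2 := hB.dist_le_mul 0 ⟨le_rfl, hT⟩ (t - S) ht'
          rw [dist_comm s S, Real.dist_eq, abs_of_nonneg (sub_nonneg.2 h')] at h1
          rw [dist_comm 0 (t - S), Real.dist_eq, sub_zero, abs_of_nonneg ht'.1] at h2
          simp only [h, h', if_true, if_false]
          have h3 := dist_triangle (σ s) (σ S) (τ (t - S))
          rw [← hστ] at h2
          have h4 := mul_le_mul_of_nonneg_right hA' (sub_nonneg.2 h')
          have h5 := mul_le_mul_of_nonneg_right hB' ht'.1
          nlinarith
        · have h2 := hB.dist_le_mul (s - S) ⟨by linarith, by linarith [hs.2]⟩ (t - S) ht'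
          rw [dist_comm (s - S), Real.dist_eq, sub_sub_sub_cancel_right,
            abs_of_nonneg (sub_nonneg.2 hst)] at h2
          simp only [h, h', if_false]
          exact h2.trans (mul_le_mul_of_nonneg_right hB' (by linarith))
    intro s hs t ht
    rcases le_total s t with hst | hst
    · rw [dist_comm s t, Real.dist_eq, abs_of_nonneg (sub_nonneg.2 hst)]
      exact key s hs t ht hst
    · rw [Real.dist_eq, abs_of_nonneg (sub_nonneg.2 hst), dist_comm]
      exact key t ht s hs hst
  speed_le := by
    have hτ' := (measurePreserving_sub_right volume S).quasiMeasurePreserving.ae hτ.speed_le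
    -- The junction `t = S`, where a corner may occur, is a null set and is discarded.
    filter_upwards [hσ.speed_le, hτ', compl_mem_ae_iff.2 (measure_singleton S)] with t h1 h2 h3 ht
    rcases lt_or_gt_of_ne (show t ≠ S from h3) with h | h
    · have e : (fun t => if t ≤ S then σ t else τ (t - S)) =ᶠ[𝓝 t] σ := by
        filter_upwards [Iio_mem_nhds h] with s hs
        simp [le_of_lt (mem_Iio.1 hs)]
      obtain ⟨h4, h5⟩ := h1 ⟨ht.1, h.le⟩
      refine ⟨h4.congr_of_eventuallyEq e, ?_⟩
      rw [e.deriv_eq]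
      simpa [h.le] using h5
    · have e : (fun t => if t ≤ S then σ t else τ (t - S)) =ᶠ[𝓝 t] fun t => τ (t - S) := by
        filter_upwards [Ioi_mem_nhds h] with s hs
        simp [not_le.2 (mem_Ioi.1 hs)]
      obtain ⟨h4, h5⟩ := h2 ⟨by linarith, by linarith [ht.2]⟩
      refine ⟨DifferentiableAt.congr_of_eventuallyEq
        (differentiableAt_comp_sub_const.2 h4) e, ?_⟩
      rw [e.deriv_eq, deriv_comp_sub_const]
      simpa [not_le.2 h] using h5

theorem IsChainLength.exists_isChainCurve {z w : EuclideanSpace ℂ (Fin d)} {L : ℝ} (hz : z ∈ Ω)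
    (h : IsChainLength Ω z w L) : ∃ σ, IsChainCurve Ω σ L ∧ σ 0 = z ∧ σ L = w := by
  obtain ⟨n, p, φ, a, b, rfl, rfl, h, rfl⟩ := h
  induction n with
  | zero => exact ⟨_, by simpa using IsChainCurve.const hz, rfl, rfl⟩
  | succ n ih =>
    obtain ⟨hφ, ha, hb, h0, h1⟩ := h n n.lt_succ_self
    obtain ⟨σ, hσ, hσ0, hσ1⟩ := ih fun i hi => h i (by omega)
    obtain ⟨τ, hτ, hτ0, hτ1⟩ := hφ.exists_isChainCurve ha hb
    have hS : 0 ≤ ∑ i ∈ Finset.range n, poincareDist (a i) (b i) :=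
      Finset.sum_nonneg fun i hi => by
        obtain ⟨-, ha, hb, -⟩ := h i (by have := Finset.mem_range.1 hi; omega)
        exact poincareDist_nonneg (by simpa using ha) (by simpa using hb)
    have hT := poincareDist_nonneg (a := a n) (b := b n) (by simpa using ha) (by simpa using hb)
    rw [Finset.sum_range_succ]
    refine ⟨_, hσ.trans hS hT hτ (by rw [hσ1, hτ0, h0]), by simp [hS, hσ0], ?_⟩
    -- If the last disc contributes length zero, the final time falls in the first branch of the
    -- concatenation, and the end point is recovered from `τ` at time `0`.
    by_cases hT0 : poincareDist (a n) (b n) ≤ 0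
    · have hT1 := le_antisymm hT0 hT
      rw [hT1] at hτ1 ⊢
      simp [hσ1, ← h1, ← hτ1, hτ0, h0]
    · simp [hT0, hτ1, h1]

/-! ### Almost-geodesics from nearly optimal chains -/

/-- A chain curve whose length exceeds the Kobayashi distance of its end points by less than `κ` is
an almost-geodesic, and so is each of its subarcs. -/
theorem IsChainCurve.isAlmostGeodesic {σ : ℝ → EuclideanSpace ℂ (Fin d)} {T κ : ℝ}
    (hσ : IsChainCurve Ω σ T) (hκ : 0 < κ) (hT : T < kobayashiDist Ω (σ 0) (σ T) + κ)
    {t₀ t₁ : ℝ} (h₀ : 0 ≤ t₀) (h₀₁ : t₀ ≤ t₁) (h₁ : t₁ ≤ T) :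
    IsAlmostGeodesic Ω 1 κ (fun t => σ (t + t₀)) 0 (t₁ - t₀) := by
  have hmem : ∀ t ∈ Icc 0 (t₁ - t₀), t + t₀ ∈ Icc 0 T := fun t ht =>
    ⟨by linarith [ht.1], by linarith [ht.2]⟩
  have hle : ∀ s ∈ Icc 0 T, ∀ t ∈ Icc 0 T, s ≤ t → kobayashiDist Ω (σ s) (σ t) ≤ t - s :=
    fun s hs t ht hst => kobayashiDist_le (hσ.chain s hs t ht hst)
  have hge : ∀ s ∈ Icc 0 T, ∀ t ∈ Icc 0 T, s ≤ t → t - s - κ ≤ kobayashiDist Ω (σ s) (σ t) := by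
    intro s hs t ht hst
    refine le_of_forall_pos_le_add fun ε hε => ?_
    obtain ⟨L, hL, hlt⟩ := exists_isChainLength_lt ⟨_, hσ.chain s hs t ht hst⟩ hε
    have hT0 : 0 ≤ T := hs.1.trans hs.2
    -- Replacing the arc from `s` to `t` by the chain of length `L` gives a chain between the end
    -- points of `σ`, so `T - κ < s + L + (T - t)`.
    have h := kobayashiDist_le (((hσ.chain 0 ⟨le_rfl, hT0⟩ s hs hs.1).trans hL).trans
      (hσ.chain t ht T ⟨hT0, le_rfl⟩ ht.2))
    linarith
  refine ⟨fun t ht => hσ.mapsTo (hmem t ht), ?_, ?_, ?_, ?_⟩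
  · intro s hs t ht
    rcases le_total s t with hst | hst
    · have := hge _ (hmem s hs) _ (hmem t ht) (by linarith)
      rw [abs_sub_comm, abs_of_nonneg (sub_nonneg.2 hst)]
      linarith
    · have := hge _ (hmem t ht) _ (hmem s hs) (by linarith)
      rw [abs_of_nonneg (sub_nonneg.2 hst), kobayashiDist_comm]
      linarith
  · intro s hs t ht
    rcases le_total s t with hst | hst
    · have := hle _ (hmem s hs) _ (hmem t ht) (by linarith)
      rw [abs_sub_comm, abs_of_nonneg (sub_nonneg.2 hst)]
      linarith
    · have := hle _ (hmem t ht) _ (hmem s hs) (by linarith)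
      rw [abs_of_nonneg (sub_nonneg.2 hst), kobayashiDist_comm]
      linarith
  · obtain ⟨C, hC⟩ := hσ.lipschitz
    refine LipschitzOnWith.absolutelyContinuousOnInterval (K := C)
      (LipschitzOnWith.of_dist_le_mul fun s hs t ht => ?_)
    rw [uIcc_of_le (sub_nonneg.2 h₀₁)] at hs ht
    simpa using hC.dist_le_mul _ (hmem s hs) _ (hmem t ht)
  · have h := (measurePreserving_add_right volume t₀).quasiMeasurePreserving.ae hσ.speed_le
    filter_upwards [h] with t h ht
    obtain ⟨h4, h5⟩ := h (hmem t ht)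
    exact ⟨differentiableAt_comp_add_const.2 h4, by rwa [deriv_comp_add_const]⟩

/-- Any two points of a domain are joined by an almost-geodesic. -/
theorem exists_isAlmostGeodesic (hopen : IsOpen Ω) (hconn : IsPreconnected Ω) {κ : ℝ} (hκ : 0 < κ)
    {z w : EuclideanSpace ℂ (Fin d)} (hz : z ∈ Ω) (hw : w ∈ Ω) :
    ∃ (T : ℝ) (σ : ℝ → EuclideanSpace ℂ (Fin d)), 0 ≤ T ∧ σ 0 = z ∧ σ T = w ∧
      ContinuousOn σ (Icc 0 T) ∧ MapsTo σ (Icc 0 T) Ω ∧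
      ∀ t₀ t₁, 0 ≤ t₀ → t₀ ≤ t₁ → t₁ ≤ T →
        IsAlmostGeodesic Ω 1 κ (fun t => σ (t + t₀)) 0 (t₁ - t₀) := by
  obtain ⟨L, hL, hlt⟩ := exists_isChainLength_lt (exists_isChainLength hopen hconn hz hw) hκ
  obtain ⟨σ, hσ, rfl, rfl⟩ := hL.exists_isChainCurve hz
  obtain ⟨C, hC⟩ := hσ.lipschitz
  exact ⟨L, σ, hL.nonneg, rfl, rfl, hC.continuousOn, hσ.mapsTo,
    fun t₀ t₁ h₀ h₀₁ h₁ => hσ.isAlmostGeodesic hκ hlt h₀ h₀₁ h₁⟩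

/-! ### Components of the complements of the exhaustion -/

/-- A connected set stays connected when a limit point is added, so components of `F` are closed
relative to `F`. -/
theorem mem_connectedComponentIn_of_mem_closure {X : Type*} [TopologicalSpace X] {F : Set X}
    {x y : X} (hy : y ∈ closure (connectedComponentIn F x)) (hyF : y ∈ F) :
    y ∈ connectedComponentIn F x := by
  by_cases hx : x ∈ F
  · have h : IsPreconnected (insert y (connectedComponentIn F x)) :=
      isPreconnected_connectedComponentIn.subset_closure (subset_insert _ _)
        (insert_subset hy subset_closure)
    exact h.subset_connectedComponentIn (mem_insert_of_mem _ (mem_connectedComponentIn hx))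
      (insert_subset hyF (connectedComponentIn_subset _ _)) (mem_insert _ _)
  · simp [connectedComponentIn_eq_empty hx] at hy

/-- A continuous path that enters a closed set does so first through the frontier. -/
theorem exists_first_mem_frontier {X : Type*} [TopologicalSpace X] {A : Set X} (hA : IsClosed A)
    {σ : ℝ → X} (hσ : Continuous σ) (h0 : σ 0 ∉ A) {t : ℝ} (ht : 0 ≤ t) (htA : σ t ∈ A) :
    ∃ s, 0 ≤ s ∧ s ≤ t ∧ σ s ∈ frontier A ∧ ∀ r, 0 ≤ r → r ≤ s → σ r ∉ interior A := by
  have hc : IsCompact (Icc 0 t ∩ σ ⁻¹' A) := isCompact_Icc.inter_right (hA.preimage hσ)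
  obtain ⟨s, ⟨⟨hs0, hst⟩, hsA⟩, hs⟩ := hc.exists_isLeast ⟨t, ⟨ht, le_rfl⟩, htA⟩
  have hlt : ∀ r, 0 ≤ r → r < s → σ r ∉ A := fun r hr0 hrs hrA =>
    absurd (hs ⟨⟨hr0, hrs.le.trans hst⟩, hrA⟩) (not_le.2 hrs)
  have hs_pos : 0 < s := hs0.lt_of_ne (by rintro rfl; exact h0 hsA)
  have hsi : σ s ∉ interior A := by
    intro hi
    have h1 : ∀ᶠ r in 𝓝[<] s, σ r ∈ interior A :=
      mem_nhdsWithin_of_mem_nhds (hσ.continuousAt (isOpen_interior.mem_nhds hi))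
    obtain ⟨r, hr, hr'⟩ := (h1.and (Ioo_mem_nhdsLT hs_pos)).exists
    exact hlt r hr'.1.le hr'.2 (interior_subset hr)
  refine ⟨s, hs0, hst, by rw [hA.frontier_eq]; exact ⟨hsA, hsi⟩, fun r hr0 hrs => ?_⟩
  rcases hrs.lt_or_eq with h | rfl
  · exact fun h' => hlt r hr0 h (interior_subset h')
  · exact hsi

variable {K : CompactExhaustion (closure Ω)}

/-- A small Euclidean ball about `c` lies in `Ω`, misses `K j` and is connected. At points of `∂Ω`
this argument is unavailable. -/
theorem eventually_connectedComponentIn_eq (hopen : IsOpen Ω) {j : ℕ} {c : closure Ω}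
    (hc : (c : EuclideanSpace ℂ (Fin d)) ∈ Ω) (hcK : c ∉ K j) :
    ∀ᶠ y in 𝓝 c, connectedComponentIn (K j)ᶜ y = connectedComponentIn (K j)ᶜ c := by
  obtain ⟨V, hV, hVK⟩ := isOpen_induced_iff.1 (K.isCompact j).isClosed.isOpen_compl
  have hcV : (c : EuclideanSpace ℂ (Fin d)) ∈ V := by
    have : c ∈ (K j)ᶜ := hcK
    rwa [← hVK] at this
  obtain ⟨r, hr, hball⟩ := Metric.isOpen_iff.1 (hV.inter hopen) _ ⟨hcV, hc⟩
  set B : Set (closure Ω) := (↑) ⁻¹' Metric.ball (c : EuclideanSpace ℂ (Fin d)) r with hB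
  have himg : (↑) '' B = Metric.ball (c : EuclideanSpace ℂ (Fin d)) r := by
    rw [hB, Subtype.image_preimage_coe]
    exact inter_eq_right.2 fun y hy => subset_closure (hball hy).2
  have hconn : IsPreconnected B := by
    rw [← IsInducing.subtypeVal.isPreconnected_image, himg]
    exact (convex_ball (c : EuclideanSpace ℂ (Fin d)) r).isPreconnected
  have hcB : c ∈ B := Metric.mem_ball_self hr
  have hBK : B ⊆ (K j)ᶜ := fun y hy => by
    rw [← hVK]
    exact (hball hy).1
  filter_upwards [(Metric.isOpen_ball.preimage continuous_subtype_val).mem_nhds hcB] with y hy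
  exact (connectedComponentIn_eq (hconn.subset_connectedComponentIn hcB hBK hy)).symm

/-- The source of every contradiction in the finiteness proof: points in pairwise distinct
components can accumulate outside `K j` only on `∂Ω`. -/
theorem not_tendsto_of_injective_component (hopen : IsOpen Ω) {j : ℕ} {c : closure Ω}
    (hc : (c : EuclideanSpace ℂ (Fin d)) ∈ Ω) (hcK : c ∉ K j) {y : ℕ → closure Ω}
    (hinj : Function.Injective fun n => connectedComponentIn (K j)ᶜ (y n))
    (hy : Tendsto y atTop (𝓝 c)) : False := by
  obtain ⟨N, hN⟩ := eventually_atTop.1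
    (hy.eventually (eventually_connectedComponentIn_eq hopen hc hcK))
  have := hinj ((hN N le_rfl).trans (hN (N + 1) N.le_succ).symm)
  omega

/-! ### Finiteness of the components that reach far out -/

/-- Points of `Ω` in different components of the complement of `K j` are joined by an
almost-geodesic, part of which crosses from the frontier of `K (j + 2)` to that of `K (j + 1)`
inside the component of the first point. -/
theorem exists_crossing_isAlmostGeodesic (hopen : IsOpen Ω) (hconn : IsPreconnected Ω) {κ : ℝ}
    (hκ : 0 < κ) {j : ℕ} {x y : closure Ω} (hx : (x : EuclideanSpace ℂ (Fin d)) ∈ Ω)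
    (hy : (y : EuclideanSpace ℂ (Fin d)) ∈ Ω) (hxK : x ∉ K (j + 2))
    (hxy : connectedComponentIn (K j)ᶜ x ≠ connectedComponentIn (K j)ᶜ y) :
    ∃ (a b : closure Ω) (S : ℝ) (τ : ℝ → EuclideanSpace ℂ (Fin d)), 0 ≤ S ∧
      IsAlmostGeodesic Ω 1 κ τ 0 S ∧ τ 0 = a ∧ τ S = b ∧
      a ∈ frontier (K (j + 2)) ∧ b ∈ frontier (K (j + 1)) ∧
      ∀ t ∈ Icc 0 S, ∃ u : closure Ω, τ t = u ∧ u ∉ interior (K (j + 1)) ∧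
        u ∈ connectedComponentIn (K j)ᶜ x := by
  obtain ⟨T, σ, hT, hσ0, hσT, hcont, hmaps, hgeo⟩ := exists_isAlmostGeodesic hopen hconn hκ hx hy
  set γ : ℝ → closure Ω := IccExtend hT fun t => ⟨σ t, subset_closure (hmaps t.2)⟩ with hγ
  have hγc : Continuous γ := by
    refine Continuous.Icc_extend' (Continuous.subtype_mk ?_ _)
    exact hcont.comp_continuous continuous_subtype_val fun t => t.2
  have hγσ : ∀ t ∈ Icc 0 T, (γ t : EuclideanSpace ℂ (Fin d)) = σ t := fun t ht => by
    rw [hγ, IccExtend_of_mem _ _ ht]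
  have hγ0 : γ 0 = x := Subtype.ext (by rw [hγσ 0 ⟨le_rfl, hT⟩, hσ0])
  have hγT : γ T = y := Subtype.ext (by rw [hγσ T ⟨hT, le_rfl⟩, hσT])
  have hmono : K j ⊆ interior (K (j + 1)) := K.subset_interior_succ j
  have hmono' : K (j + 1) ⊆ K (j + 2) := K.subset_succ (j + 1)
  -- A path avoiding `K j` would put its two end points in one component.
  obtain ⟨t, ht, htK⟩ : ∃ t ∈ Icc 0 T, γ t ∈ K j := by
    by_contra! h
    refine hxy (connectedComponentIn_eq ?_)
    have hpre : IsPreconnected (γ '' Icc 0 T) := isPreconnected_Icc.image γ hγc.continuousOn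
    refine hpre.subset_connectedComponentIn ⟨0, ⟨le_rfl, hT⟩, hγ0⟩ ?_ ⟨T, ⟨hT, le_rfl⟩, hγT⟩
    rintro _ ⟨t, ht, rfl⟩
    exact h t ht
  -- `t₁` is a first entry into `K (j + 1)`, and `t₀ ≤ t₁` below one into `K (j + 2)`. Up to `t₁`
  -- the path avoids the interior of `K (j + 1)`, hence `K j`, and so stays in the component of `x`.
  obtain ⟨t₁, h10, h1t, h1, h1'⟩ := exists_first_mem_frontier (K.isCompact (j + 1)).isClosed hγc
    (by rw [hγ0]; exact fun h => hxK (hmono' h)) ht.1 (interior_subset (hmono htK))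
  obtain ⟨t₀, h00, h01, h0, -⟩ := exists_first_mem_frontier (K.isCompact (j + 2)).isClosed hγc
    (by rwa [hγ0]) h10 (hmono' ((K.isCompact (j + 1)).isClosed.frontier_subset h1))
  have h1T : t₁ ≤ T := h1t.trans ht.2
  refine ⟨γ t₀, γ t₁, t₁ - t₀, fun t => σ (t + t₀), sub_nonneg.2 h01,
    hgeo t₀ t₁ h00 h01 h1T, ?_, ?_, h0, h1, fun s hs => ?_⟩
  · simp [hγσ t₀ ⟨h00, h01.trans h1T⟩]
  · simp [hγσ t₁ ⟨h10, h1T⟩]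
  · have hs0 : 0 ≤ s + t₀ := by linarith [hs.1]
    have hs1 : s + t₀ ≤ t₁ := by linarith [hs.2]
    refine ⟨γ (s + t₀), (hγσ _ ⟨hs0, hs1.trans h1T⟩).symm, h1' _ hs0 hs1, ?_⟩
    have hpre : IsPreconnected (γ '' Icc 0 t₁) := isPreconnected_Icc.image γ hγc.continuousOn
    refine hpre.subset_connectedComponentIn ⟨0, ⟨le_rfl, h10⟩, hγ0⟩ ?_ ⟨_, ⟨hs0, hs1⟩, rfl⟩
    rintro _ ⟨r, hr, rfl⟩
    exact fun h => h1' r hr.1 hr.2 (hmono h)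

theorem isCompact_frontier_exhaustion (K : CompactExhaustion (closure Ω)) (j : ℕ) :
    IsCompact (frontier (K j)) :=
  (K.isCompact j).of_isClosed_subset isClosed_frontier (K.isCompact j).isClosed.frontier_subset

/-- In a visibility domain only finitely many components of the complement of `K j` contain points
of `Ω` outside `K (j + 2)`. -/
theorem IsVisibilityDomain.finite_components_inter (hopen : IsOpen Ω) (hconn : IsPreconnected Ω)
    {κ : ℝ} (hκ : 0 < κ) (hvis : IsVisibilityDomain Ω K 1 κ) (j : ℕ) :
    {F | ∃ x : closure Ω, (x : EuclideanSpace ℂ (Fin d)) ∈ Ω ∧ x ∉ K (j + 2) ∧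
      F = connectedComponentIn (K j)ᶜ x}.Finite := by
  by_contra hinf
  let e := Set.Infinite.natEmbedding _ hinf
  choose x hxΩ hxK hxe using fun n => (e n).2
  have hinj : Function.Injective fun n => connectedComponentIn (K j)ᶜ (x n) := by
    intro m n hmn
    refine e.injective (Subtype.ext ?_)
    rw [hxe m, hxe n]
    exact hmn
  -- `x 0` is the common target of the almost-geodesics, which start at the points `x (n + 1)`.
  have hne : ∀ n, connectedComponentIn (K j)ᶜ (x (n + 1)) ≠ connectedComponentIn (K j)ᶜ (x 0) :=
    fun n h => by simpa using hinj h
  choose a b S τ hS hτ hτa hτb ha hb hu using fun n =>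
    exists_crossing_isAlmostGeodesic hopen hconn hκ (hxΩ (n + 1)) (hxΩ 0) (hxK (n + 1)) (hne n)
  have hmem : ∀ y : ℕ → closure Ω, (∀ n, y n ∈ connectedComponentIn (K j)ᶜ (x (n + 1))) →
      Function.Injective fun n => connectedComponentIn (K j)ᶜ (y n) := by
    intro y hy m n hmn
    simp only [← connectedComponentIn_eq (hy _)] at hmn
    simpa using hinj hmn
  have haF : ∀ n, a n ∈ connectedComponentIn (K j)ᶜ (x (n + 1)) := fun n => by
    obtain ⟨u, hu1, -, hu2⟩ := hu n 0 ⟨le_rfl, hS n⟩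
    rwa [Subtype.ext ((hτa n).symm.trans hu1)]
  have hbF : ∀ n, b n ∈ connectedComponentIn (K j)ᶜ (x (n + 1)) := fun n => by
    obtain ⟨u, hu1, -, hu2⟩ := hu n (S n) ⟨hS n, le_rfl⟩
    rwa [Subtype.ext ((hτb n).symm.trans hu1)]
  have hKj : K j ⊆ interior (K (j + 1)) := K.subset_interior_succ j
  have hKj' : K (j + 1) ⊆ interior (K (j + 2)) := K.subset_interior_succ (j + 1)
  obtain ⟨⟨a₀, b₀⟩, ⟨ha₀, hb₀⟩, φ, hφ, hlim⟩ :=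
    ((isCompact_frontier_exhaustion K (j + 2)).prod
      (isCompact_frontier_exhaustion K (j + 1))).tendsto_subseq
        (x := fun n => (a n, b n)) fun n => ⟨ha n, hb n⟩
  have hlima : Tendsto (a ∘ φ) atTop (𝓝 a₀) := (continuous_fst.tendsto (a₀, b₀)).comp hlim
  have hlimb : Tendsto (b ∘ φ) atTop (𝓝 b₀) := (continuous_snd.tendsto (a₀, b₀)).comp hlim
  have hb₀K : b₀ ∉ interior (K (j + 1)) := hb₀.2
  have ha₀K : a₀ ∉ interior (K (j + 2)) := ha₀.2
  have ha₀Ω : (a₀ : EuclideanSpace ℂ (Fin d)) ∉ Ω := fun h =>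
    not_tendsto_of_injective_component hopen h
      (fun h' => ha₀K (hKj' (interior_subset (hKj h')))) ((hmem a haF).comp hφ.injective) hlima
  have hb₀Ω : (b₀ : EuclideanSpace ℂ (Fin d)) ∉ Ω := fun h =>
    not_tendsto_of_injective_component hopen h
      (fun h' => hb₀K (hKj h')) ((hmem b hbF).comp hφ.injective) hlimb
  -- The frontier of `K (j + 1)` lies in the interior of `K (j + 2)`. Two shells beyond `K j` are
  -- used precisely to keep the two limits apart.
  have hab : a₀ ≠ b₀ := by
    rintro rfl
    exact ha₀K (hKj' ((K.isCompact (j + 1)).isClosed.frontier_subset hb₀))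
  have hbdry : ∀ p : closure Ω, (p : EuclideanSpace ℂ (Fin d)) ∉ Ω →
      EndCompactification.pt p ∈ endBoundary Ω K := by
    rintro p hp q hpq
    injection hpq with hpq
    rwa [← hpq]
  obtain ⟨V, hV, W, hW, -, C, hC, hCΩ, hvisC⟩ := hvis _ (hbdry a₀ ha₀Ω) _ (hbdry b₀ hb₀Ω)
    (fun h => hab (by injection h))
  have hpt := (EndCompactification.isOpenEmbedding_pt K).continuous
  have hev : ∀ᶠ n in atTop, EndCompactification.pt (a (φ n)) ∈ V ∧
      EndCompactification.pt (b (φ n)) ∈ W :=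
    (((hpt.tendsto a₀).comp hlima).eventually hV).and (((hpt.tendsto b₀).comp hlimb).eventually hW)
  obtain ⟨N, hN⟩ := eventually_atTop.1 hev
  -- Visibility for the pair `a₀`, `b₀`: each late crossing has a point in `C`, still in its own
  -- component and off the interior of `K (j + 1)`.
  have hc : ∀ n, ∃ c : closure Ω, (c : EuclideanSpace ℂ (Fin d)) ∈ C ∧ c ∉ interior (K (j + 1)) ∧
      c ∈ connectedComponentIn (K j)ᶜ (x (φ (n + N) + 1)) := by
    intro n
    obtain ⟨hVn, hWn⟩ := hN (n + N) (by omega)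
    obtain ⟨_, ⟨t, ht, rfl⟩, htC⟩ := hvisC (S (φ (n + N))) (τ (φ (n + N))) (hS _) (hτ _)
      (by rw [hτa]; exact ⟨_, hVn⟩) (by rw [hτb]; exact ⟨_, hWn⟩)
    obtain ⟨u, hu1, hu2, hu3⟩ := hu _ t ht
    exact ⟨u, hu1 ▸ htC, hu2, hu3⟩
  choose c hcC hcK hcF using hc
  have hC' : IsCompact ((↑) ⁻¹' C : Set (closure Ω)) :=
    isClosed_closure.isClosedEmbedding_subtypeVal.isCompact_preimage hC
  obtain ⟨c₀, hc₀, ψ, hψ, hlimc⟩ := hC'.tendsto_subseq hcC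
  have hc₀K : c₀ ∉ interior (K (j + 1)) :=
    isOpen_interior.isClosed_compl.mem_of_tendsto hlimc (Eventually.of_forall fun n => hcK (ψ n))
  refine not_tendsto_of_injective_component hopen (hCΩ hc₀) (fun h => hc₀K (hKj h)) ?_ hlimc
  intro m n hmn
  simp only [Function.comp_apply, ← connectedComponentIn_eq (hcF _)] at hmn
  have h1 := hφ.injective (Nat.succ_injective (hinj hmn))
  exact hψ.injective (by omega)

/-- In a visibility domain only finitely many components of the complement of `K j` reach outside
`K (j + 2)`. -/
theorem IsVisibilityDomain.finite_components (hopen : IsOpen Ω) (hconn : IsPreconnected Ω)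
    {κ : ℝ} (hκ : 0 < κ) (hvis : IsVisibilityDomain Ω K 1 κ) (j : ℕ) :
    {F | ∃ x ∉ K (j + 2), F = connectedComponentIn (K j)ᶜ x}.Finite := by
  have hfin := hvis.finite_components_inter hopen hconn hκ j
  refine hfin.subset ?_
  rintro _ ⟨x, hx, rfl⟩
  have hsub : K j ⊆ K (j + 2) := K.subset (by omega)
  have hdense : Dense ((↑) ⁻¹' Ω : Set (closure Ω)) := by
    rw [Subtype.dense_iff]
    intro y hy
    rwa [Subtype.image_preimage_coe, inter_eq_right.2 subset_closure]
  have hxcl := hdense.open_subset_closure_inter (K.isCompact (j + 2)).isClosed.isOpen_compl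
    (show x ∈ (K (j + 2))ᶜ from hx)
  set 𝒮 := {F | ∃ x : closure Ω, (x : EuclideanSpace ℂ (Fin d)) ∈ Ω ∧ x ∉ K (j + 2) ∧
    F = connectedComponentIn (K j)ᶜ x}
  have hcover : ((K (j + 2))ᶜ ∩ (↑) ⁻¹' Ω : Set (closure Ω)) ⊆ ⋃ F ∈ 𝒮, F := fun y hy =>
    mem_iUnion₂.2 ⟨_, ⟨y, hy.2, hy.1, rfl⟩, mem_connectedComponentIn fun h => hy.1 (hsub h)⟩
  replace hxcl := closure_mono hcover hxcl
  -- Finiteness enters here: `x` is a limit of points of `Ω` in finitely many components, hence in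
  -- the closure of a single one.
  rw [hfin.closure_biUnion] at hxcl
  obtain ⟨_, ⟨y, hyΩ, hyK, rfl⟩, hxF⟩ := mem_iUnion₂.1 hxcl
  exact ⟨y, hyΩ, hyK, (connectedComponentIn_eq
    (mem_connectedComponentIn_of_mem_closure hxF fun h => hx (hsub h))).symm⟩

/-! ### The topology at the ends -/

namespace EndCompactification

variable {X : Type*} [TopologicalSpace X] {K : CompactExhaustion X}

theorem spaceEnd_subset_compl (e : SpaceEnd K) (j : ℕ) : e.F j ⊆ (K j)ᶜ := by
  obtain ⟨x, -, h⟩ := e.isComponent j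
  rw [h]
  exact connectedComponentIn_subset _ _

theorem spaceEnd_eq_component (e : SpaceEnd K) {j : ℕ} {x : X} (hx : x ∈ e.F j) :
    e.F j = connectedComponentIn (K j)ᶜ x := by
  obtain ⟨y, -, h⟩ := e.isComponent j
  rw [h] at hx ⊢
  exact connectedComponentIn_eq hx

/-- A substitute for local connectedness: the closures of the finitely many other far-reaching
components have a closed union, and it misses `x` because components are relatively closed. -/
theorem component_mem_nhds [T2Space X] {j : ℕ}
    (hfin : {F | ∃ x ∉ K (j + 2), F = connectedComponentIn (K j)ᶜ x}.Finite) {x : X}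
    (hx : x ∉ K (j + 2)) : connectedComponentIn (K j)ᶜ x ∈ 𝓝 x := by
  have hsub : K j ⊆ K (j + 2) := K.subset (by omega)
  set 𝒮 := {F | ∃ x ∉ K (j + 2), F = connectedComponentIn (K j)ᶜ x} \
    {connectedComponentIn (K j)ᶜ x}
  have hcl : IsClosed (⋃ F ∈ 𝒮, closure F) :=
    (hfin.subset sdiff_subset).isClosed_biUnion fun _ _ => isClosed_closure
  have hx' : x ∈ (⋃ F ∈ 𝒮, closure F)ᶜ := by
    intro h
    obtain ⟨_, ⟨⟨y, -, rfl⟩, hne⟩, hxF⟩ := mem_iUnion₂.1 h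
    exact hne (connectedComponentIn_eq
      (mem_connectedComponentIn_of_mem_closure hxF fun h => hx (hsub h)))
  filter_upwards [hcl.isOpen_compl.mem_nhds hx',
    (K.isCompact (j + 2)).isClosed.isOpen_compl.mem_nhds hx] with y hy hyK
  have hyc : y ∈ connectedComponentIn (K j)ᶜ y := mem_connectedComponentIn fun h => hyK (hsub h)
  by_contra hne
  refine hy (mem_iUnion₂.2 ⟨connectedComponentIn (K j)ᶜ y, ⟨⟨y, hyK, rfl⟩, fun h => hne ?_⟩,
    subset_closure hyc⟩)
  rw [mem_singleton_iff] at h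
  rwa [← h]

/-- Points of `e.F j` inside `K (j + 2)` need not be interior to it, so the open set used keeps only
the interior of `e.F j`. -/
theorem endNhd_mem_nhds [T2Space X] {j : ℕ}
    (hfin : {F | ∃ x ∉ K (j + 2), F = connectedComponentIn (K j)ᶜ x}.Finite) (e : SpaceEnd K) :
    endNhd e j ∈ 𝓝 (atEnd e) := by
  have hopen : IsOpen (pt '' interior (e.F j) ∪
      atEnd '' {f : SpaceEnd K | ∀ i ≤ j, f.F i = e.F i} : Set (EndCompactification K)) := by
    refine ⟨?_, ?_⟩
    · rintro x (⟨y, hy, hyx⟩ | ⟨f, -, hf⟩)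
      · injection hyx with hyx
        subst hyx
        exact mem_of_superset (isOpen_interior.mem_nhds hy) fun z hz => Or.inl ⟨z, hz, rfl⟩
      · cases hf
    · rintro f (⟨y, -, hy⟩ | ⟨g, hg, hgf⟩)
      · cases hy
      · injection hgf with hgf
        subst hgf
        -- Points of `g.F (j + 2)` lie outside `K (j + 2)`, so each is interior to its component
        -- `g.F j = e.F j`.
        refine ⟨j + 2, ?_⟩
        rintro p (⟨x, hx, rfl⟩ | ⟨f, hf, rfl⟩)
        · refine Or.inl ⟨x, ?_, rfl⟩
          have hxj : x ∈ g.F j := antitone_nat_of_succ_le g.anti (by omega) hx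
          rw [← hg j le_rfl, spaceEnd_eq_component g hxj, mem_interior_iff_mem_nhds]
          exact component_mem_nhds hfin (spaceEnd_subset_compl g _ hx)
        · exact Or.inr ⟨f, fun i hi => (hf i (by omega)).trans (hg i hi), rfl⟩
  refine mem_of_superset (hopen.mem_nhds (Or.inr ⟨e, fun _ _ => rfl, rfl⟩)) ?_
  exact union_subset_union_left _ (image_mono interior_subset)

theorem hasBasis_nhds_atEnd [T2Space X]
    (hfin : ∀ j, {F | ∃ x ∉ K (j + 2), F = connectedComponentIn (K j)ᶜ x}.Finite)
    (e : SpaceEnd K) : (𝓝 (atEnd e)).HasBasis (fun _ : ℕ => True) (endNhd e) := by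
  refine ⟨fun U => ⟨fun hU => ?_, fun ⟨j, _, hj⟩ =>
    mem_of_superset (endNhd_mem_nhds (hfin j) e) hj⟩⟩
  obtain ⟨V, hVU, hV, heV⟩ := mem_nhds_iff.1 hU
  obtain ⟨j, hj⟩ := hV.2 e heV
  exact ⟨j, trivial, hj.trans hVU⟩

/-! ### Sequences that escape to an end -/

/-- The component of the complement of `K j` in which a point of the end compactification lies. -/
def component (K : CompactExhaustion X) (j : ℕ) : EndCompactification K → Set X
  | pt x => connectedComponentIn (K j)ᶜ x
  | atEnd e => e.F j

theorem component_succ_subset (p : EndCompactification K) (j : ℕ) :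
    component K (j + 1) p ⊆ component K j p := by
  cases p with
  | pt x => exact connectedComponentIn_mono x (compl_subset_compl.2 (K.subset_succ j))
  | atEnd e => exact e.anti j

theorem exists_component_eq {p : EndCompactification K} {j : ℕ} (hp : p ∉ pt '' K (j + 2)) :
    ∃ x ∉ K (j + 2), component K j p = connectedComponentIn (K j)ᶜ x := by
  cases p with
  | pt x => exact ⟨x, fun h => hp ⟨x, h, rfl⟩, rfl⟩
  | atEnd e =>
    obtain ⟨x, hx, h⟩ := e.isComponent (j + 2)
    have hxe : x ∈ e.F (j + 2) := h ▸ mem_connectedComponentIn hx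
    exact ⟨x, hx, spaceEnd_eq_component e (antitone_nat_of_succ_le e.anti (by omega) hxe)⟩

theorem mem_endNhd {e : SpaceEnd K} {p : EndCompactification K} {j : ℕ} (hp : p ∉ pt '' K j)
    (h : ∀ i ≤ j, component K i p = e.F i) : p ∈ endNhd e j := by
  cases p with
  | pt x =>
    refine Or.inl ⟨x, ?_, rfl⟩
    rw [← h j le_rfl]
    exact mem_connectedComponentIn fun hx => hp ⟨x, hx, rfl⟩
  | atEnd f => exact Or.inr ⟨f, h, rfl⟩

/-- A nonprincipal ultrafilter applies the pigeonhole principle at all levels at once. The chosen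
components are nested because the events at levels `j` and `j + 1` occur at a common index. -/
theorem exists_tendsto_atEnd [T2Space X]
    (hfin : ∀ j, {F | ∃ x ∉ K (j + 2), F = connectedComponentIn (K j)ᶜ x}.Finite)
    {p : ℕ → EndCompactification K} (hp : ∀ j, ∀ᶠ n in atTop, p n ∉ pt '' K j) :
    ∃ (e : SpaceEnd K) (φ : ℕ → ℕ), StrictMono φ ∧ Tendsto (p ∘ φ) atTop (𝓝 (atEnd e)) := by
  have hle := Nat.hyperfilter_le_atTop
  have hF : ∀ j, ∃ F ∈ {F | ∃ x ∉ K (j + 2), F = connectedComponentIn (K j)ᶜ x},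
      ∀ᶠ n in (hyperfilter ℕ : Filter ℕ), component K j (p n) = F := by
    intro j
    refine (Ultrafilter.eventually_exists_mem_iff (hfin j)).1 ?_
    filter_upwards [hle (hp (j + 2))] with n hn
    exact ⟨_, exists_component_eq hn, rfl⟩
  choose F hFmem hFev using hF
  let e : SpaceEnd K :=
    { F := F
      isComponent := fun j => by
        obtain ⟨x, hx, h⟩ := hFmem j
        exact ⟨x, fun hxK => hx (K.subset (by omega) hxK), h⟩
      anti := fun j => by
        obtain ⟨n, h1, h2⟩ := ((hFev (j + 1)).and (hFev j)).exists
        rw [← h1, ← h2]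
        exact component_succ_subset _ _ }
  -- An event in the ultrafilter happens for infinitely many indices, which allows extraction of an
  -- honest subsequence.
  have hfreq : ∀ k, ∃ᶠ n in atTop, p n ∈ endNhd e k := by
    intro k
    refine Frequently.filter_mono (Eventually.frequently ?_) hle
    filter_upwards [hle (hp k), (finite_Iic k).eventually_all.2 fun i _ => hFev i] with n hn h
    exact mem_endNhd hn h
  obtain ⟨φ, hφ, hmem⟩ := extraction_forall_of_frequently hfreq
  refine ⟨e, φ, hφ, (hasBasis_nhds_atEnd hfin e).tendsto_right_iff.2 fun k _ => ?_⟩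
  filter_upwards [eventually_ge_atTop k] with n hn
  exact endNhd_anti e hn (hmem n)

/-- Either the sequence escapes every `K j` and subconverges to an end, or it returns infinitely
often to one `K j`, which is sequentially compact. -/
theorem seqCompactSpace [T2Space X] [FirstCountableTopology X]
    (hfin : ∀ j, {F | ∃ x ∉ K (j + 2), F = connectedComponentIn (K j)ᶜ x}.Finite) :
    SeqCompactSpace (EndCompactification K) := by
  refine ⟨fun p _ => ?_⟩
  by_cases hp : ∀ j, ∀ᶠ n in atTop, p n ∉ pt '' K j
  · obtain ⟨e, φ, hφ, h⟩ := exists_tendsto_atEnd hfin hp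
    exact ⟨_, mem_univ _, φ, hφ, h⟩
  · push Not at hp
    obtain ⟨j, hj⟩ := hp
    obtain ⟨φ, hφ, hφK⟩ := extraction_of_frequently_atTop hj
    choose x hxK hx using hφK
    obtain ⟨x₀, -, ψ, hψ, hlim⟩ := (K.isCompact j).tendsto_subseq hxK
    refine ⟨pt x₀, mem_univ _, φ ∘ ψ, hφ.comp hψ, ?_⟩
    have h := ((isOpenEmbedding_pt K).continuous.tendsto x₀).comp hlim
    exact h.congr fun n => hx (ψ n)

end EndCompactification

end Visibility

end

theorem theorem3p6 (d : ℕ) (Ω : Set (EuclideanSpace ℂ (Fin d)))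
    (hopen : IsOpen Ω) (hconn : IsConnected Ω) (hunb : ¬ Bornology.IsBounded Ω)
    (hhyp : Visibility.IsKobayashiHyperbolic Ω)
    (K : CompactExhaustion (closure Ω))
    (hvis : ∃ κ : ℝ, 0 < κ ∧ Visibility.IsVisibilityDomain Ω K 1 κ) :
    (∀ e : Visibility.SpaceEnd K,
      (𝓝 (Visibility.EndCompactification.atEnd e)).HasBasis (fun _ : ℕ => True)
        (Visibility.EndCompactification.endNhd e)) ∧
    SeqCompactSpace (Visibility.EndCompactification K) := by
  obtain ⟨κ, hκ, hvis⟩ := hvis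
  have hfin := hvis.finite_components hopen hconn.isPreconnected hκ
  exact ⟨Visibility.EndCompactification.hasBasis_nhds_atEnd hfin,
    Visibility.EndCompactification.seqCompactSpace hfin⟩
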